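/- Let $B_1$ be the open unit disc of $\mathbb R^2$. There exists a Lipschitz function $u : B_1 \to \mathbb R$ that is subharmonic in the sense of distributions (that is, $\Delta u \ge 0$ as a distribution on $B_1$) and such that, for every nonempty open set $\Omega' \subset B_1$, the distribution $\partial_{11} u$ restricted to $\Omega'$ is not a finite signed measure on $\Omega'$. -/

import Mathlib

open scoped Distributions LineDeriv

/-- Euclidean space of dimension `n` (coordinates are indexed from `0`, so `∂₁` is `∂ᵢ` at `i = 0`). -/
abbrev Eucl (n : ℕ) : Type := EuclideanSpace ℝ (Fin n)

/-- The open unit ball `B₁` of `ℝⁿ`, as an open set. -/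
def unitBall (n : ℕ) : TopologicalSpace.Opens (Eucl n) :=
  ⟨Metric.ball 0 1, Metric.isOpen_ball⟩

/-- The distribution `φ ↦ ∫ φ u` on the open set `Ω` given by a function `u` that is locally
integrable on `Ω` (only the values of `u` on `Ω` matter, since the `φ` are supported in `Ω`). -/
noncomputable def distributionOf {n : ℕ} (Ω : TopologicalSpace.Opens (Eucl n)) (u : Eucl n → ℝ) :
    𝓓'(Ω, ℝ) :=
  ContinuousLinearMap.toUniformConvergenceCLM _ _ _
    (TestFunction.integralAgainstBilinCLM (ContinuousLinearMap.mul ℝ ℝ) MeasureTheory.volume u)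

/-- The pure second distributional derivative `∂ᵢᵢ T` of a distribution `T`. -/
noncomputable def pureSecondDeriv {n : ℕ} {Ω : TopologicalSpace.Opens (Eucl n)} (i : Fin n)
    (T : 𝓓'(Ω, ℝ)) : 𝓓'(Ω, ℝ) :=
  ∂_{EuclideanSpace.single i (1 : ℝ)} (∂_{EuclideanSpace.single i (1 : ℝ)} T)

/-- `u` is subharmonic on `Ω` in the sense of distributions: `u ∈ L¹_loc(Ω)` and
`Δu = ∑ᵢ ∂ᵢᵢ u` is a nonnegative distribution on `Ω`. -/
def IsDistribSubharmonicOn {n : ℕ} (Ω : TopologicalSpace.Opens (Eucl n)) (u : Eucl n → ℝ) : Prop :=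
  MeasureTheory.LocallyIntegrableOn u Ω MeasureTheory.volume ∧
    ∀ φ : 𝓓(Ω, ℝ), (∀ x, 0 ≤ φ x) →
      0 ≤ ∑ i : Fin n, pureSecondDeriv i (distributionOf Ω u) φ

/-- The distribution `T` on `Ω` is a finite signed Borel measure on `Ω`. (Finite signed measures on
`Ω` are the restrictions to `Ω` of finite signed measures on `ℝⁿ`, and integrals of test functions
supported in `Ω` only see this restriction.) -/
def IsFiniteSignedMeasure {n : ℕ} {Ω : TopologicalSpace.Opens (Eucl n)} (T : 𝓓'(Ω, ℝ)) : Prop :=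
  ∃ σ : MeasureTheory.SignedMeasure (Eucl n), ∀ φ : 𝓓(Ω, ℝ), T φ = ∫ᵛ x, φ x ∂•σ

open MeasureTheory TopologicalSpace

/-! In the plane `log |x|²` is harmonic off the origin, while `∂₁₁ log |x|²` is homogeneous of
degree `-2`, so each dyadic annulus carries the same mass of it and the total diverges
logarithmically. A bound on the Laplacian thus gives no bound on the mass of `∂₁₁`.

`exists_oscillating_block` makes this quantitative. A periodic array of wells `ν⁻² log (dist² +
ν⁻²)`, in coordinates scaled by `ν`, is bounded by 3, 1-Lipschitz and has Laplacian at least `-4`.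
Yet its `∂₁₁` has mass of order `ρ² log ν` on a disc of radius `ρ`, hence arbitrarily large.

Take `u = 2|x|² + ∑ 2⁻ᵏ W k` over a subset of the indices `k`, where the blocks `W k` serve a
countable family of discs containing one inside every nonempty open set, each disc infinitely often.
The quadratic term, of Laplacian 8, absorbs the total loss `4 ∑ 2⁻ᵏ`. Since blocks could cancel one
another, the subset is not explicit: `exists_subseries_unbounded` finds it by Baire category in `ℕ →
Bool`, so that `∂₁₁ u` is unbounded on test functions of sup norm at most 1 in every disc. -/

/-! ### Test functions, integration by parts, finite measures. -/

/-- The pure second partial derivative `∂ᵢᵢ φ` of a test function `φ`. -/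
noncomputable def TestFunction.pureSecondDeriv {n : ℕ} {Ω : Opens (Eucl n)} (i : Fin n)
    (φ : 𝓓(Ω, ℝ)) : 𝓓(Ω, ℝ) :=
  ∂_{EuclideanSpace.single i (1 : ℝ)} (∂_{EuclideanSpace.single i (1 : ℝ)} φ)

theorem pureSecondDeriv_apply {n : ℕ} {Ω : Opens (Eucl n)} (i : Fin n) (T : 𝓓'(Ω, ℝ))
    (φ : 𝓓(Ω, ℝ)) : pureSecondDeriv i T φ = T (φ.pureSecondDeriv i) := by
  simp [pureSecondDeriv, TestFunction.pureSecondDeriv]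

theorem distributionOf_apply {n : ℕ} (Ω : Opens (Eucl n)) {u : Eucl n → ℝ} (hu : Continuous u)
    (φ : 𝓓(Ω, ℝ)) : distributionOf Ω u φ = ∫ x, φ x * u x :=
  TestFunction.integralAgainstBilinCLM_eq_integral
    (B := ContinuousLinearMap.mul ℝ ℝ) (hu.locallyIntegrable.locallyIntegrableOn _)

theorem TestFunction.hasLineDerivAt {n : ℕ} {Ω : Opens (Eucl n)} (φ : 𝓓(Ω, ℝ)) (x v : Eucl n) :
    HasLineDerivAt ℝ φ ((∂_{v} φ) x) x v := by
  have h : DifferentiableAt ℝ φ x := φ.contDiff.differentiable (by simp) x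
  rw [TestFunction.lineDerivOp_eq_lineDerivCLM ℝ, TestFunction.lineDerivCLM_apply_of_le (by simp)]
  exact h.lineDifferentiableAt.hasLineDerivAt

theorem TestFunction.integrable_mul_continuous {n : ℕ} {Ω : Opens (Eucl n)} (φ : 𝓓(Ω, ℝ))
    {u : Eucl n → ℝ} (hu : Continuous u) : Integrable (fun x ↦ φ x * u x) :=
  (φ.continuous.mul hu).integrable_of_hasCompactSupport φ.hasCompactSupport.mul_right

theorem integral_lineDeriv_mul_eq_neg {n : ℕ} {Ω : Opens (Eucl n)} (φ : 𝓓(Ω, ℝ)) (v : Eucl n)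
    {f f' : Eucl n → ℝ} (hf : Continuous f) (hf' : Continuous f')
    (h : ∀ x, HasLineDerivAt ℝ f (f' x) x v) :
    ∫ x, (∂_{v} φ) x * f x = - ∫ x, φ x * f' x := by
  rw [← neg_eq_iff_eq_neg]
  exact (integral_bilinear_hasLineDerivAt_right_eq_neg_left_of_integrable
    (B := ContinuousLinearMap.mul ℝ ℝ) ((∂_{v} φ).integrable_mul_continuous hf)
    (φ.integrable_mul_continuous hf') (φ.integrable_mul_continuous hf)
    (fun x _ ↦ φ.hasLineDerivAt x v) (fun x _ ↦ h x)).symm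

theorem integral_pureSecondDeriv_mul {n : ℕ} {Ω : Opens (Eucl n)} (φ : 𝓓(Ω, ℝ)) (i : Fin n)
    {f f' f'' : Eucl n → ℝ} (hf : Continuous f) (hf' : Continuous f') (hf'' : Continuous f'')
    (h : ∀ x, HasLineDerivAt ℝ f (f' x) x (EuclideanSpace.single i 1))
    (h' : ∀ x, HasLineDerivAt ℝ f' (f'' x) x (EuclideanSpace.single i 1)) :
    ∫ x, φ.pureSecondDeriv i x * f x = ∫ x, φ x * f'' x := by
  rw [TestFunction.pureSecondDeriv, integral_lineDeriv_mul_eq_neg _ _ hf hf' h,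
    integral_lineDeriv_mul_eq_neg φ _ hf' hf'' h', neg_neg]

/-- The total variation of a finite signed measure is finite; this bound is the only consequence of
finiteness that gets contradicted. -/
theorem IsFiniteSignedMeasure.exists_bound {n : ℕ} {Ω : Opens (Eucl n)} {T : 𝓓'(Ω, ℝ)}
    (hT : IsFiniteSignedMeasure T) :
    ∃ C : ℝ, ∀ φ : 𝓓(Ω, ℝ), (∀ x, |φ x| ≤ 1) → |T φ| ≤ C := by
  obtain ⟨σ, hσ⟩ := hT
  have : IsFiniteMeasure σ.variation := by
    rw [← SignedMeasure.totalVariation_eq_variation]; infer_instance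
  refine ⟨1 * ‖ContinuousLinearMap.lsmul ℝ ℝ (E := ℝ)‖ * σ.variation.real Set.univ,
    fun φ hφ ↦ ?_⟩
  rw [hσ, ← Real.norm_eq_abs]
  exact VectorMeasure.norm_integral_le_of_norm_le_const
    (.of_forall fun x ↦ (Real.norm_eq_abs _).trans_le (hφ x))

/-! ### Choice of a sub-series by Baire category. -/

/-- Condensation of singularities for sub-series: if countably many families of summable sequences
have unbounded coefficients at infinitely many places, then some sub-series is unbounded on each
family. -/
theorem exists_subseries_unbounded {ι : Type*} [Countable ι] {Φ : ι → Type*}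
    (c : ∀ b, Φ b → ℝ) (a : ∀ b, Φ b → ℕ → ℝ) (ha : ∀ b φ, Summable (a b φ))
    (hunb : ∀ b (N : ℝ), ∃ᶠ k in Filter.atTop, ∃ φ, N ≤ |a b φ k|) :
    ∃ t : ℕ → Bool, ∀ b (N : ℝ), ∃ φ, N < |c b φ + ∑' k, if t k then a b φ k else 0| := by
  have hsum : ∀ b φ (t : ℕ → Bool), Summable fun k ↦ if t k then a b φ k else 0 := fun b φ t ↦
    (ha b φ).norm.of_norm_bounded fun k ↦ by split_ifs <;> simp
  have hcont : ∀ b φ, Continuous fun t : ℕ → Bool ↦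
      |c b φ + ∑' k, if t k then a b φ k else 0| := fun b φ ↦ by
    refine (continuous_const.add (continuous_tsum (fun k ↦ ?_) (ha b φ).norm fun k t ↦ ?_)).abs
    · exact (continuous_of_discreteTopology (f := fun s : Bool ↦ if s then a b φ k else 0)).comp
        (continuous_apply k)
    · split_ifs <;> simp
  by_contra! h
  let F : ι × ℕ → Set (ℕ → Bool) := fun p ↦
    {t | ∀ φ, |c p.1 φ + ∑' k, if t k then a p.1 φ k else 0| ≤ p.2}
  have hF : ∀ p, IsClosed (F p) := fun p ↦ by
    simp only [F, Set.ofPred_forall]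
    exact isClosed_iInter fun φ ↦ isClosed_le (hcont _ φ) continuous_const
  have hU : ⋃ p, F p = Set.univ := by
    refine Set.eq_univ_of_forall fun t ↦ ?_
    obtain ⟨b, N, hN⟩ := h t
    obtain ⟨m, hm⟩ := exists_nat_ge N
    exact Set.mem_iUnion.2 ⟨(b, m), fun φ ↦ (hN φ).trans hm⟩
  obtain ⟨⟨b, m⟩, t, ht⟩ := nonempty_interior_of_iUnion_of_closed hF hU
  obtain ⟨I, u, hu, hsub⟩ := isOpen_pi_iff.1 isOpen_interior t ht
  -- Beyond the finitely many coordinates in `I`, switching term `k` on or off stays in `F (b, m)`.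
  -- The two sums are at most `m` in absolute value but differ by a term of size at least `2m + 1`.
  obtain ⟨k, ⟨φ, hφ⟩, hk⟩ := ((hunb b (2 * m + 1)).and_eventually
    (Filter.eventually_gt_atTop (I.sup id))).exists
  have hkI : k ∉ I := fun hI ↦ (Finset.le_sup (f := id) hI).not_gt hk
  have hmem : ∀ s : Bool, Function.update t k s ∈ F (b, m) := fun s ↦ by
    refine interior_subset (hsub fun j hj ↦ ?_)
    rw [Function.update_of_ne (by rintro rfl; exact hkI hj)]
    exact (hu j hj).2
  have h1 := abs_le.1 (hmem true φ)
  have h2 := abs_le.1 (hmem false φ)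
  have hd : (∑' j, if Function.update t k true j then a b φ j else 0) -
      (∑' j, if Function.update t k false j then a b φ j else 0) = a b φ k := by
    rw [← (hsum b φ _).tsum_sub (hsum b φ _), tsum_eq_single k]
    · simp
    · intro j hj
      simp [Function.update_of_ne hj]
  simp only at h1 h2
  rcases le_abs.1 hφ with h3 | h3 <;> linarith

/-! ### Geometrically weighted sub-series of blocks. -/

/-- The sub-series `∑_{t k} 2⁻ᵏ W k`. -/
noncomputable def geometricSubseries {E : Type*} (W : ℕ → E → ℝ) (t : ℕ → Bool) (x : E) : ℝ :=
  ∑' k, (1 / 2) ^ k * (if t k then W k x else 0)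

section

variable {E : Type*} {W : ℕ → E → ℝ} {C : ℝ}

theorem norm_geometricSubseries_term_le (hW : ∀ k x, |W k x| ≤ C) (t : ℕ → Bool) (k : ℕ) (x : E) :
    ‖(1 / 2 : ℝ) ^ k * (if t k then W k x else 0)‖ ≤ (1 / 2) ^ k * C := by
  have hC : 0 ≤ C := (abs_nonneg _).trans (hW k x)
  rw [norm_mul, norm_pow, Real.norm_of_nonneg (by norm_num : (0 : ℝ) ≤ 1 / 2)]
  gcongr
  split_ifs
  · exact hW k x
  · simpa

theorem summable_geometricSubseries (hW : ∀ k x, |W k x| ≤ C) (t : ℕ → Bool) (x : E) :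
    Summable fun k ↦ (1 / 2 : ℝ) ^ k * (if t k then W k x else 0) :=
  (summable_geometric_two.mul_right C).of_norm_bounded
    fun k ↦ norm_geometricSubseries_term_le hW t k x

theorem lipschitzWith_geometricSubseries [PseudoMetricSpace E] (hW : ∀ k x, |W k x| ≤ C)
    (hL : ∀ k, LipschitzWith 1 (W k)) (t : ℕ → Bool) :
    LipschitzWith 2 (geometricSubseries W t) := by
  refine LipschitzWith.of_dist_le_mul fun x y ↦ ?_
  rw [Real.dist_eq, geometricSubseries, geometricSubseries,
    ← (summable_geometricSubseries hW t x).tsum_sub (summable_geometricSubseries hW t y),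
    ← Real.norm_eq_abs]
  refine tsum_of_norm_bounded (hasSum_geometric_two.mul_right (dist x y)) fun k ↦ ?_
  rw [← mul_sub, norm_mul, norm_pow, Real.norm_of_nonneg (by norm_num : (0 : ℝ) ≤ 1 / 2)]
  gcongr
  split_ifs
  · simpa [Real.dist_eq] using (hL k).dist_le_mul x y
  · simp

theorem hasSum_integral_mul_geometricSubseries {n : ℕ} {W : ℕ → Eucl n → ℝ}
    (hW : ∀ k x, |W k x| ≤ C) (hc : ∀ k, Continuous (W k)) (t : ℕ → Bool)
    {Ω : Opens (Eucl n)} (φ : 𝓓(Ω, ℝ)) :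
    HasSum (fun k ↦ if t k then (1 / 2) ^ k * ∫ x, φ x * W k x else 0)
      (∫ x, φ x * geometricSubseries W t x) := by
  have hφ : Integrable φ := by simpa using φ.integrable_mul_continuous (u := 1) continuous_const
  have key := hasSum_integral_of_dominated_convergence (μ := (volume : Measure (Eucl n)))
    (F := fun k x ↦ φ x * ((1 / 2 : ℝ) ^ k * (if t k then W k x else 0)))
    (f := fun x ↦ φ x * geometricSubseries W t x)
    (fun k x ↦ |φ x| * ((1 / 2) ^ k * C)) (fun k ↦ ?_) (fun k ↦ .of_forall fun x ↦ ?_)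
    (.of_forall fun x ↦ (summable_geometric_two.mul_right C).mul_left _) ?_
    (.of_forall fun x ↦ (summable_geometricSubseries hW t x).hasSum.mul_left _)
  · have he : (fun k ↦ if t k then (1 / 2) ^ k * ∫ x, φ x * W k x else 0) =
        fun k ↦ ∫ x, φ x * ((1 / 2 : ℝ) ^ k * (if t k then W k x else 0)) := by
      funext k
      split_ifs
      · rw [← integral_const_mul]
        congr 1 with x
        ring
      · simp
    rw [he]
    exact key
  · refine (φ.continuous.mul (continuous_const.mul ?_)).aestronglyMeasurable
    split_ifs
    exacts [hc k, continuous_const]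
  · rw [norm_mul]
    exact mul_le_mul_of_nonneg_left (norm_geometricSubseries_term_le hW t k x) (norm_nonneg _)
  · simp only [tsum_mul_left]
    exact hφ.abs.mul_const _

end

/-! ### Periodic logarithmic wells. -/

/-- The regularised squared distance to the lattice `q + (π / ν) ℤⁿ`, in units of `ν⁻²`. -/
noncomputable def latticeDistSq {n : ℕ} (ν : ℝ) (q x : Eucl n) : ℝ :=
  ∑ j, Real.sin (ν * (x j - q j)) ^ 2 + (ν ^ 2)⁻¹

/-- A bounded, Lipschitz, periodic function with a logarithmic well at each point of the lattice
`q + (π / ν) ℤⁿ`. -/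
noncomputable def latticeLog {n : ℕ} (ν : ℝ) (q x : Eucl n) : ℝ :=
  (ν ^ 2)⁻¹ * Real.log (latticeDistSq ν q x)

/-- The pure second derivative `∂ᵢᵢ` of `latticeLog ν q`. -/
noncomputable def latticeLogSecond {n : ℕ} (ν : ℝ) (q : Eucl n) (i : Fin n) (x : Eucl n) : ℝ :=
  (2 * Real.cos (2 * (ν * (x i - q i))) * latticeDistSq ν q x -
    Real.sin (2 * (ν * (x i - q i))) ^ 2) / latticeDistSq ν q x ^ 2

section

variable {n : ℕ} {ν : ℝ} {q : Eucl n}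

theorem latticeDistSq_pos (hν : 0 < ν) (x : Eucl n) : 0 < latticeDistSq ν q x := by
  unfold latticeDistSq
  positivity

theorem continuous_latticeDistSq : Continuous (latticeDistSq ν q) := by
  unfold latticeDistSq
  fun_prop

theorem continuous_latticeLogSecond (hν : 0 < ν) (i : Fin n) :
    Continuous (latticeLogSecond ν q i) := by
  have h := continuous_latticeDistSq (ν := ν) (q := q)
  unfold latticeLogSecond
  refine Continuous.div (by fun_prop) (by fun_prop) fun x ↦ ?_
  exact (pow_pos (latticeDistSq_pos hν x) 2).ne'

theorem hasDerivAt_scaled_coord (x v : Eucl n) (j : Fin n) :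
    HasDerivAt (fun t : ℝ ↦ ν * ((x + t • v) j - q j)) (ν * v j) 0 := by
  have h := (((hasDerivAt_id (0 : ℝ)).mul_const (v j)).const_add (x j - q j)).const_mul ν
  simp only [one_mul] at h
  refine h.congr_of_eventuallyEq (.of_forall fun t ↦ ?_)
  simp only [PiLp.add_apply, PiLp.smul_apply, smul_eq_mul, id_eq]
  ring

theorem hasLineDerivAt_latticeDistSq (x v : Eucl n) :
    HasLineDerivAt ℝ (latticeDistSq ν q)
      (ν * ∑ j, Real.sin (2 * (ν * (x j - q j))) * v j) x v := by
  have h := (HasDerivAt.fun_sum fun (j : Fin n) (_ : j ∈ Finset.univ) ↦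
    ((hasDerivAt_scaled_coord (ν := ν) (q := q) x v j).sin.pow 2)).add_const (ν ^ 2)⁻¹
  refine h.congr_deriv ?_
  rw [Finset.mul_sum]
  refine Finset.sum_congr rfl fun j _ ↦ ?_
  simp [Real.sin_two_mul]
  ring

theorem hasLineDerivAt_latticeLog (hν : 0 < ν) (x v : Eucl n) :
    HasLineDerivAt ℝ (latticeLog ν q)
      (ν⁻¹ * (∑ j, Real.sin (2 * (ν * (x j - q j))) * v j) / latticeDistSq ν q x) x v := by
  have h := ((hasLineDerivAt_latticeDistSq (ν := ν) (q := q) x v).log (by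
    simpa using (latticeDistSq_pos hν x).ne')).const_mul (ν ^ 2)⁻¹
  refine h.congr_deriv ?_
  simp only [zero_smul, add_zero]
  field_simp

theorem hasLineDerivAt_latticeLog_single (hν : 0 < ν) (i : Fin n) (x : Eucl n) :
    HasLineDerivAt ℝ (latticeLog ν q)
      (ν⁻¹ * Real.sin (2 * (ν * (x i - q i))) / latticeDistSq ν q x) x
      (EuclideanSpace.single i 1) := by
  convert hasLineDerivAt_latticeLog hν x (EuclideanSpace.single i 1) using 1
  simp

theorem hasLineDerivAt_latticeLog_single_single (hν : 0 < ν) (i : Fin n) (x : Eucl n) :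
    HasLineDerivAt ℝ (fun y ↦ ν⁻¹ * Real.sin (2 * (ν * (y i - q i))) / latticeDistSq ν q y)
      (latticeLogSecond ν q i x) x (EuclideanSpace.single i 1) := by
  have hP := (latticeDistSq_pos (q := q) hν x).ne'
  have h1 := (((hasDerivAt_scaled_coord (ν := ν) (q := q) x (EuclideanSpace.single i 1)
    i).const_mul 2).sin.const_mul ν⁻¹)
  have h := h1.div (hasLineDerivAt_latticeDistSq (ν := ν) (q := q) x (EuclideanSpace.single i 1))
    (by simpa using hP)
  refine h.congr_deriv ?_
  simp [latticeLogSecond]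
  field_simp

theorem continuous_latticeLog (hν : 0 < ν) : Continuous (latticeLog ν q) :=
  continuous_const.mul (continuous_latticeDistSq.log fun x ↦ (latticeDistSq_pos hν x).ne')

theorem integral_pureSecondDeriv_mul_latticeLog (hν : 0 < ν) {Ω : Opens (Eucl n)} (φ : 𝓓(Ω, ℝ))
    (i : Fin n) :
    ∫ x, φ.pureSecondDeriv i x * latticeLog ν q x = ∫ x, φ x * latticeLogSecond ν q i x := by
  refine integral_pureSecondDeriv_mul φ i (continuous_latticeLog hν) ?_
    (continuous_latticeLogSecond hν i) (hasLineDerivAt_latticeLog_single hν i)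
    (hasLineDerivAt_latticeLog_single_single hν i)
  have h := continuous_latticeDistSq (ν := ν) (q := q)
  exact Continuous.div (by fun_prop) h fun x ↦ (latticeDistSq_pos hν x).ne'

theorem sum_sin_two_mul_sq_le (x : Eucl n) :
    ∑ j, Real.sin (2 * (ν * (x j - q j))) ^ 2 ≤ 4 * (latticeDistSq ν q x - (ν ^ 2)⁻¹) := by
  rw [latticeDistSq, add_sub_cancel_right, Finset.mul_sum]
  refine Finset.sum_le_sum fun j _ ↦ ?_
  rw [Real.sin_two_mul, mul_pow, mul_pow, Real.cos_sq']
  nlinarith [sq_nonneg (Real.sin (ν * (x j - q j)) ^ 2)]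

theorem lipschitzWith_latticeLog (hν : 0 < ν) : LipschitzWith 1 (latticeLog ν q) := by
  have hd : Differentiable ℝ (latticeLog ν q) := by
    unfold latticeLog
    refine Differentiable.const_mul (Differentiable.log ?_ fun x ↦ (latticeDistSq_pos hν x).ne') _
    unfold latticeDistSq
    fun_prop
  refine lipschitzWith_of_nnnorm_fderiv_le hd fun x ↦ ?_
  change ‖fderiv ℝ (latticeLog ν q) x‖ ≤ (1 : ℝ)
  refine ContinuousLinearMap.opNorm_le_bound _ zero_le_one fun v ↦ ?_
  have hP := latticeDistSq_pos (q := q) hν x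
  have hs := sum_sin_two_mul_sq_le (ν := ν) (q := q) x
  rw [← (hd x).lineDeriv_eq_fderiv, (hasLineDerivAt_latticeLog hν x v).lineDeriv, one_mul,
    Real.norm_eq_abs, abs_div, abs_of_pos hP, div_le_iff₀ hP]
  refine abs_le_of_sq_le_sq ?_ (by positivity)
  have hcs := Finset.sum_mul_sq_le_sq_mul_sq Finset.univ
    (fun j ↦ Real.sin (2 * (ν * (x j - q j)))) v
  rw [← EuclideanSpace.real_norm_sq_eq] at hcs
  set P := latticeDistSq ν q x
  -- With `a = ν⁻²`, this is `4a(P - a) ≤ P²`, a perfect square: the regularisation `a` is what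
  -- makes the Lipschitz constant 1.
  have h1 : (ν⁻¹) ^ 2 * (4 * (P - (ν ^ 2)⁻¹)) ≤ P ^ 2 := by
    have := sq_nonneg (P - 2 * (ν ^ 2)⁻¹)
    rw [inv_pow]
    nlinarith
  calc _ = (ν⁻¹) ^ 2 * (∑ j, Real.sin (2 * (ν * (x j - q j))) * v j) ^ 2 := by ring
    _ ≤ (ν⁻¹) ^ 2 * (4 * (P - (ν ^ 2)⁻¹) * ‖v‖ ^ 2) := by
      gcongr
      exact hcs.trans (by gcongr)
    _ ≤ (‖v‖ * P) ^ 2 := by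
      rw [mul_pow, mul_comm (‖v‖ ^ 2), ← mul_assoc]
      gcongr

end

theorem abs_latticeLog_le {ν : ℝ} (hν : 1 ≤ ν) (q x : Eucl 2) : |latticeLog ν q x| ≤ 3 := by
  have hν0 : 0 < ν := by linarith
  have hP := latticeDistSq_pos (q := q) hν0 x
  have ha : (ν ^ 2)⁻¹ ≤ 1 := inv_le_one_of_one_le₀ (one_le_pow₀ hν)
  have ha0 : 0 < (ν ^ 2)⁻¹ := by positivity
  have hle : latticeDistSq ν q x ≤ 3 := by
    rw [latticeDistSq, Fin.sum_univ_two]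
    linarith [Real.sin_sq_le_one (ν * (x 0 - q 0)), Real.sin_sq_le_one (ν * (x 1 - q 1))]
  have hge : (ν ^ 2)⁻¹ ≤ latticeDistSq ν q x := le_add_of_nonneg_left (by positivity)
  have h1 := Real.log_le_sub_one_of_pos hP
  have h2 := Real.one_sub_inv_le_log_of_pos hP
  have h3 : (latticeDistSq ν q x)⁻¹ ≤ ν ^ 2 := inv_le_of_inv_le₀ (by positivity) hge
  have h4 : (ν ^ 2)⁻¹ * ν ^ 2 = 1 := inv_mul_cancel₀ (by positivity)
  rw [latticeLog, abs_le]
  constructor <;> nlinarith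

/-- Harmonicity of `log |x|²` in dimension two appears as the cancellation of the terms `4(s² +
r²)`. With `a = ν⁻²` the numerator is `-4P² + 4aP + 4a + 4(s⁴ + r⁴)`, hence at least `-4P²`. -/
theorem neg_four_le_sum_latticeLogSecond {ν : ℝ} (hν : 0 < ν) (q x : Eucl 2) :
    -4 ≤ ∑ i, latticeLogSecond ν q i x := by
  have hP := latticeDistSq_pos (q := q) hν x
  have hPe : latticeDistSq ν q x = Real.sin (ν * (x 0 - q 0)) ^ 2 +
      Real.sin (ν * (x 1 - q 1)) ^ 2 + (ν ^ 2)⁻¹ := by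
    rw [latticeDistSq, Fin.sum_univ_two]
  have ha : 0 < (ν ^ 2)⁻¹ := by positivity
  simp only [Fin.sum_univ_two, latticeLogSecond]
  rw [← add_div, le_div_iff₀ (by positivity)]
  simp only [Real.cos_two_mul, Real.sin_two_mul, mul_pow, Real.cos_sq']
  set P := latticeDistSq ν q x
  set s := Real.sin (ν * (x 0 - q 0))
  set r := Real.sin (ν * (x 1 - q 1))
  rw [hPe] at hP ⊢
  nlinarith [sq_nonneg (s ^ 2), sq_nonneg (r ^ 2), mul_pos ha hP]

theorem neg_four_mul_integral_le_sum_latticeLog {ν : ℝ} (hν : 0 < ν) (q : Eucl 2)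
    {Ω : Opens (Eucl 2)} (φ : 𝓓(Ω, ℝ)) (hφ : ∀ x, 0 ≤ φ x) :
    -4 * ∫ x, φ x ≤ ∑ i : Fin 2, ∫ x, φ.pureSecondDeriv i x * latticeLog ν q x := by
  simp only [integral_pureSecondDeriv_mul_latticeLog hν]
  rw [← integral_finsetSum _ fun i _ ↦
    φ.integrable_mul_continuous (continuous_latticeLogSecond hν i), ← integral_const_mul]
  refine integral_mono ?_ ?_ fun x ↦ ?_
  · simpa only [mul_comm] using
      φ.integrable_mul_continuous (u := fun _ ↦ (-4 : ℝ)) continuous_const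
  · exact integrable_finsetSum _ fun i _ ↦
      φ.integrable_mul_continuous (continuous_latticeLogSecond hν i)
  · simp only [← Finset.mul_sum]
    rw [mul_comm]
    exact mul_le_mul_of_nonneg_left (neg_four_le_sum_latticeLogSecond hν q x) (hφ x)

/-- Near `(l, 0)` the term `sin² z` dominates `sin² w + a`, so the numerator is at most `-l²/8`,
while the denominator is at most `4l⁴`. -/
theorem log_well_second_deriv_le {z w l a : ℝ} (hl : l ≤ 1 / 2)
    (hz : |z - l| ≤ l / 4) (hw : |w| ≤ l / 4) (ha : 0 < a) (hal : a ≤ l ^ 2 / 16) :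
    (2 * Real.cos (2 * z) * (Real.sin z ^ 2 + Real.sin w ^ 2 + a) - Real.sin (2 * z) ^ 2) /
      (Real.sin z ^ 2 + Real.sin w ^ 2 + a) ^ 2 ≤ -(1 / (32 * l ^ 2)) := by
  obtain ⟨hz1, hz2⟩ := abs_le.1 hz
  have hl0 : 0 < l := by
    have : 0 ≤ l := by linarith [abs_nonneg w]
    rcases this.eq_or_lt with rfl | h
    · norm_num at hal; linarith
    · exact h
  have hpi := Real.pi_gt_three
  have hpi' := Real.pi_lt_d2
  have hsin : 0.45 * l ≤ Real.sin z := by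
    have h := Real.mul_le_sin (by linarith : 0 ≤ z) (by linarith)
    have h2 : 0.6 ≤ 2 / Real.pi := by rw [le_div_iff₀ Real.pi_pos]; linarith
    nlinarith
  have hs1 : 0.2 * l ^ 2 ≤ Real.sin z ^ 2 := by nlinarith
  have hs2 : Real.sin z ^ 2 ≤ 25 / 16 * l ^ 2 := by
    have := Real.sin_sq_le_sq (x := z)
    nlinarith
  have hr : Real.sin w ^ 2 ≤ 1 / 16 * l ^ 2 := by
    have := Real.sin_sq_le_sq (x := w)
    have := sq_le_sq' (by linarith [abs_nonneg w]) hw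
    rw [sq_abs] at this
    nlinarith
  have hr0 := sq_nonneg (Real.sin w)
  rw [Real.cos_two_mul, Real.sin_two_mul, mul_pow, mul_pow, Real.cos_sq']
  set s := Real.sin z ^ 2
  set r := Real.sin w ^ 2
  have hs0 : 0 < s := by nlinarith
  have hP : 0 < s + r + a := by positivity
  have hP2 : s + r + a ≤ 2 * l ^ 2 := by nlinarith
  have hPsq : (s + r + a) ^ 2 ≤ 4 * l ^ 4 := by nlinarith
  rw [div_le_iff₀ (by positivity)]
  have hnum : 2 * (2 * (1 - s) - 1) * (s + r + a) - 2 ^ 2 * s * (1 - s) ≤ -(1 / 8 * l ^ 2) := by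
    nlinarith [mul_pos hs0 ha, mul_nonneg hs0.le hr0]
  refine hnum.trans ?_
  rw [neg_mul, neg_le_neg_iff, div_mul_eq_mul_div, div_le_iff₀ (by positivity)]
  nlinarith

theorem abs_scaled_coord_le {n : ℕ} {ν r : ℝ} (hν : 0 < ν) {x c : Eucl n}
    (hx : dist x c ≤ r / ν) (j : Fin n) : |ν * (x j - c j)| ≤ r := by
  rw [abs_mul, abs_of_pos hν, ← le_div_iff₀' hν]
  refine le_trans ?_ hx
  rw [dist_eq_norm]
  exact PiLp.norm_apply_le (x - c) j

/-! ### Discs on which `∂₁₁` of a well is very negative. -/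

/-- The point `q + (π i + l, π j) / ν`. -/
noncomputable def wellPoint (ν : ℝ) (q : Eucl 2) (l : ℝ) (i j : ℕ) : Eucl 2 :=
  !₂[q 0 + (Real.pi * i + l) / ν, q 1 + Real.pi * j / ν]

section

variable {ν l : ℝ} {q x : Eucl 2} {i j : ℕ}

theorem abs_sub_le_of_dist_wellPoint_le (hν : 0 < ν)
    (hx : dist x (wellPoint ν q l i j) ≤ l / 4 / ν) :
    |ν * (x 0 - q 0) - i * Real.pi - l| ≤ l / 4 ∧ |ν * (x 1 - q 1) - j * Real.pi| ≤ l / 4 := by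
  have h0 := abs_scaled_coord_le hν hx 0
  have h1 := abs_scaled_coord_le hν hx 1
  simp only [wellPoint, PiLp.toLp_apply, Matrix.cons_val_zero, Matrix.cons_val_one] at h0 h1
  refine ⟨?_, ?_⟩
  · convert h0 using 2
    field_simp
    ring
  · convert h1 using 2
    field_simp
    ring

theorem latticeLogSecond_le_of_dist_wellPoint_le (hν : 0 < ν) (hl : l ≤ 1 / 2) (hlν : 4 ≤ l * ν)
    (hx : dist x (wellPoint ν q l i j) ≤ l / 4 / ν) :
    latticeLogSecond ν q 0 x ≤ -(1 / (32 * l ^ 2)) := by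
  obtain ⟨h0, h1⟩ := abs_sub_le_of_dist_wellPoint_le hν hx
  have ha : (ν ^ 2)⁻¹ ≤ l ^ 2 / 16 := by
    rw [inv_le_iff_one_le_mul₀ (by positivity)]
    nlinarith
  convert log_well_second_deriv_le hl h0 h1 (by positivity) ha using 1
  have hsq : ∀ (y : ℝ) (m : ℕ), Real.sin (y - m * Real.pi) ^ 2 = Real.sin y ^ 2 := fun y m ↦ by
    rw [Real.sin_sub_nat_mul_pi, mul_pow, ← pow_mul, mul_comm m 2, pow_mul]
    simp
  have hc : ∀ (y : ℝ) (m : ℕ), Real.cos (2 * (y - m * Real.pi)) = Real.cos (2 * y) := fun y m ↦ by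
    rw [← Real.cos_sub_nat_mul_two_pi (2 * y) m]
    ring_nf
  have hs : ∀ (y : ℝ) (m : ℕ), Real.sin (2 * (y - m * Real.pi)) = Real.sin (2 * y) := fun y m ↦ by
    rw [← Real.sin_sub_nat_mul_two_pi (2 * y) m]
    ring_nf
  rw [latticeLogSecond, latticeDistSq, Fin.sum_univ_two, hsq, hsq, hc, hs]

/-- Wells are `π` apart, and at one well the dyadic scales `l` separate the discs of radius `l/4`.
Hence a sum of bumps on these discs still has sup norm at most 1. -/
theorem wellPoint_disjoint {i' j' k k' : ℕ} (hν : 0 < ν) (hk : 1 ≤ k) (hk' : 1 ≤ k')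
    (hx : dist x (wellPoint ν q ((1 / 2) ^ k) i j) ≤ (1 / 2) ^ k / 4 / ν)
    (hx' : dist x (wellPoint ν q ((1 / 2) ^ k') i' j') ≤ (1 / 2) ^ k' / 4 / ν) :
    (i, j, k) = (i', j', k') := by
  obtain ⟨h0, h1⟩ := abs_sub_le_of_dist_wellPoint_le hν hx
  obtain ⟨h0', h1'⟩ := abs_sub_le_of_dist_wellPoint_le hν hx'
  rw [abs_le] at h0 h1 h0' h1'
  have hpi := Real.pi_gt_three
  have hhalf : ∀ {m m' : ℕ}, m < m' → (1 / 2 : ℝ) ^ m' ≤ (1 / 2) ^ m / 2 := fun {m m'} h ↦ by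
    calc (1 / 2 : ℝ) ^ m' ≤ (1 / 2) ^ (m + 1) :=
          pow_le_pow_of_le_one (by norm_num) (by norm_num) h
      _ = _ := by ring
  have hpos : ∀ m : ℕ, (0 : ℝ) < (1 / 2) ^ m := fun m ↦ by positivity
  have hle : ∀ {m : ℕ}, 1 ≤ m → (1 / 2 : ℝ) ^ m ≤ 1 / 2 := fun {m} h ↦ by
    simpa using hhalf (m := 0) h
  have key : ∀ {m m' : ℕ}, m < m' → (m : ℝ) * Real.pi + 3 ≤ m' * Real.pi := fun {m m'} h ↦ by
    have : (m : ℝ) + 1 ≤ m' := mod_cast h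
    nlinarith
  have e := hle hk
  have e' := hle hk'
  have p := hpos k
  have p' := hpos k'
  obtain rfl : i = i' := by
    rcases lt_trichotomy i i' with h | h | h
    · linarith [key h]
    · exact h
    · linarith [key h]
  obtain rfl : j = j' := by
    rcases lt_trichotomy j j' with h | h | h
    · linarith [key h]
    · exact h
    · linarith [key h]
  obtain rfl : k = k' := by
    rcases lt_trichotomy k k' with h | h | h
    · linarith [hhalf h]
    · exact h
    · linarith [hhalf h]
  rfl

theorem closedBall_wellPoint_subset {m : ℕ} {ρ : ℝ} (hν : 0 < ν) (hl0 : 0 < l) (hl : l ≤ 1 / 2)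
    (hi : i < m) (hj : j < m) (hρ : 2 * (Real.pi * m) ≤ ρ * ν) :
    Metric.closedBall (wellPoint ν q l i j) (l / 4 / ν) ⊆ Metric.ball q ρ := by
  intro x hx
  obtain ⟨h0, h1⟩ := abs_sub_le_of_dist_wellPoint_le hν hx
  rw [abs_le] at h0 h1
  have hpi := Real.pi_gt_three
  have hi' : (i : ℝ) + 1 ≤ m := mod_cast hi
  have hj' : (j : ℝ) + 1 ≤ m := mod_cast hj
  have hi0 : (0 : ℝ) ≤ i * Real.pi := by positivity
  have hj0 : (0 : ℝ) ≤ j * Real.pi := by positivity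
  have hM : 0 < Real.pi * m := by nlinarith [(Nat.cast_nonneg i : (0 : ℝ) ≤ i)]
  have b0 : (ν * (x 0 - q 0)) ^ 2 ≤ (Real.pi * m) ^ 2 := by
    refine sq_le_sq' ?_ ?_ <;> nlinarith
  have b1 : (ν * (x 1 - q 1)) ^ 2 ≤ (Real.pi * m) ^ 2 := by
    refine sq_le_sq' ?_ ?_ <;> nlinarith
  have hρ0 : 0 < ρ * ν := by linarith
  rw [mem_ball_iff_norm, ← mul_lt_mul_iff_left₀ hν]
  refine lt_of_pow_lt_pow_left₀ 2 hρ0.le ?_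
  rw [mul_pow, EuclideanSpace.real_norm_sq_eq, Fin.sum_univ_two]
  simp only [PiLp.sub_apply]
  nlinarith

end

/-! ### The building block with large `∂₁₁` mass. -/

theorem exists_oscillating_block (q : Eucl 2) {ρ : ℝ} (hρ : 0 < ρ) (N : ℝ) :
    ∃ W : Eucl 2 → ℝ, LipschitzWith 1 W ∧ (∀ x, |W x| ≤ 3) ∧
      (∀ (Ω : Opens (Eucl 2)) (φ : 𝓓(Ω, ℝ)), (∀ x, 0 ≤ φ x) →
        -4 * ∫ x, φ x ≤ ∑ i : Fin 2, ∫ x, φ.pureSecondDeriv i x * W x) ∧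
      ∃ φ : 𝓓(⟨Metric.ball q ρ, Metric.isOpen_ball⟩, ℝ), (∀ x, |φ x| ≤ 1) ∧
        N ≤ |∫ x, φ.pureSecondDeriv 0 x * W x| := by
  classical
  have hpi := Real.pi_gt_three
  -- `K` is the number of dyadic scales per well and fixes the mass. `m²` is the number of wells,
  -- taken so large that the regularisation is negligible down to scale `2⁻ᴷ`. The factor 2 in `ν`
  -- makes the array fit in the ball.
  obtain ⟨K, hK⟩ := exists_nat_ge (N * (8192 * Real.pi) / ρ ^ 2)
  obtain ⟨m, hm⟩ := exists_nat_ge (4 * 2 ^ K * ρ + 1)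
  have hm1 : (1 : ℝ) ≤ m := le_trans (le_add_of_nonneg_left (by positivity)) hm
  set ν : ℝ := 2 * (Real.pi * m) / ρ with hνdef
  have hρν : ρ * ν = 2 * (Real.pi * m) := by rw [hνdef]; field_simp
  have hν : 0 < ν := by positivity
  have hνK : 4 * 2 ^ K ≤ ν := by
    rw [hνdef, le_div_iff₀ hρ]
    nlinarith
  have hlν : ∀ k ∈ Finset.Icc 1 K, (4 : ℝ) ≤ (1 / 2) ^ k * ν := fun k hk ↦ by
    rw [one_div, inv_pow, ← div_eq_inv_mul, le_div_iff₀ (by positivity)]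
    refine le_trans ?_ hνK
    gcongr
    · norm_num
    · exact (Finset.mem_Icc.1 hk).2
  have hlhalf : ∀ k ∈ Finset.Icc 1 K, (1 / 2 : ℝ) ^ k ≤ 1 / 2 := fun k hk ↦
    pow_le_of_le_one (by norm_num) (by norm_num) (by have := (Finset.mem_Icc.1 hk).1; omega)
  let T : Finset (ℕ × ℕ × ℕ) := Finset.range m ×ˢ Finset.range m ×ˢ Finset.Icc 1 K
  have hT : ∀ b ∈ T, b.1 < m ∧ b.2.1 < m ∧ b.2.2 ∈ Finset.Icc 1 K := fun b hb ↦ by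
    simpa only [T, Finset.mem_product, Finset.mem_range] using hb
  let bump : ∀ b : ℕ × ℕ × ℕ, ContDiffBump (wellPoint ν q ((1 / 2) ^ b.2.2) b.1 b.2.1) := fun b ↦
    { rIn := (1 / 2) ^ b.2.2 / 8 / ν
      rOut := (1 / 2) ^ b.2.2 / 4 / ν
      rIn_pos := by positivity
      rIn_lt_rOut := by gcongr; norm_num }
  have hdist : ∀ b x, bump b x ≠ 0 →
      dist x (wellPoint ν q ((1 / 2) ^ b.2.2) b.1 b.2.1) ≤ (1 / 2) ^ b.2.2 / 4 / ν :=
    fun b x hx ↦ not_lt.1 fun h ↦ hx ((bump b).zero_of_le_dist h.le)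
  let B : Opens (Eucl 2) := ⟨Metric.ball q ρ, Metric.isOpen_ball⟩
  let χ : T → 𝓓(B, ℝ) := fun b ↦
    { toFun := bump b
      contDiff' := (bump b).contDiff
      hasCompactSupport' := (bump b).hasCompactSupport
      tsupport_subset' := by
        obtain ⟨h1, h2, h3⟩ := hT b b.2
        rw [(bump b).tsupport_eq]
        exact closedBall_wellPoint_subset hν (by positivity) (hlhalf _ h3) h1 h2 hρν.ge }
  have hχ : ∀ b x, χ b x = bump b x := fun b x ↦ rfl
  let φ : 𝓓(B, ℝ) := ∑ b, χ b
  have hφ : ∀ x, φ x = ∑ b, χ b x := fun x ↦ by simp [φ]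
  refine ⟨latticeLog ν q, lipschitzWith_latticeLog hν, abs_latticeLog_le ?_ q,
    fun Ω ψ hψ ↦ neg_four_mul_integral_le_sum_latticeLog hν q ψ hψ, φ, fun x ↦ ?_, ?_⟩
  · have : (1 : ℝ) ≤ 2 ^ K := one_le_pow₀ (by norm_num)
    linarith
  · rw [hφ, abs_of_nonneg (Finset.sum_nonneg fun b _ ↦ by rw [hχ]; exact (bump b).nonneg)]
    by_cases h : ∃ b, χ b x ≠ 0
    · obtain ⟨b, hb⟩ := h
      rw [Finset.sum_eq_single b]
      · exact (bump b).le_one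
      · intro b' _ hne
        by_contra hb'
        refine hne (Subtype.ext (wellPoint_disjoint hν ?_ ?_ (hdist _ _ hb') (hdist _ _ hb)))
        · exact (Finset.mem_Icc.1 (hT b' b'.2).2.2).1
        · exact (Finset.mem_Icc.1 (hT b b.2).2.2).1
      · simp
    · push Not at h
      simp [h]
  · rw [integral_pureSecondDeriv_mul_latticeLog hν]
    simp only [hφ, Finset.sum_mul]
    rw [integral_finsetSum _ fun b _ ↦
      (χ b).integrable_mul_continuous (continuous_latticeLogSecond hν 0)]
    -- The bound `1/(32 l²)` times the area `π (l/(8ν))²` where the bump equals 1: the scale `l`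
    -- cancels.
    have hterm : ∀ b : T, ∫ x, χ b x * latticeLogSecond ν q 0 x ≤
        -(Real.pi / (2048 * ν ^ 2)) := fun ⟨b, hb⟩ ↦ by
      obtain ⟨-, -, hk⟩ := hT b hb
      set l : ℝ := (1 / 2) ^ b.2.2
      have hl : 0 < l := by positivity
      have hint : Integrable (χ ⟨b, hb⟩) volume := by
        simpa using (χ ⟨b, hb⟩).integrable_mul_continuous (u := 1) continuous_const
      have h1 : ∫ x, χ ⟨b, hb⟩ x * latticeLogSecond ν q 0 x ≤
          ∫ x, χ ⟨b, hb⟩ x * -(1 / (32 * l ^ 2)) := by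
        refine integral_mono
          ((χ ⟨b, hb⟩).integrable_mul_continuous (continuous_latticeLogSecond hν 0))
          (hint.mul_const _) fun x ↦ ?_
        by_cases hx : bump b x = 0
        · simp [hχ, hx]
        · exact mul_le_mul_of_nonneg_left (latticeLogSecond_le_of_dist_wellPoint_le hν
            (hlhalf _ hk) (hlν _ hk) (hdist b x hx)) (bump b).nonneg
      refine h1.trans ?_
      have h2 := (bump b).measure_closedBall_le_integral volume
      rw [measureReal_def, EuclideanSpace.volume_closedBall_fin_two] at h2
      rw [integral_mul_const, mul_neg, neg_le_neg_iff]
      have h3 : (l / 8 / ν) ^ 2 * Real.pi ≤ ∫ x, χ ⟨b, hb⟩ x := by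
        refine le_trans (le_of_eq ?_) h2
        have : 0 ≤ l / 8 / ν := by positivity
        rw [ENNReal.toReal_mul, ENNReal.toReal_pow, ENNReal.toReal_ofReal this,
          ENNReal.toReal_ofReal Real.pi_pos.le]
      calc Real.pi / (2048 * ν ^ 2) = (l / 8 / ν) ^ 2 * Real.pi * (1 / (32 * l ^ 2)) := by
            field_simp
            norm_num
        _ ≤ _ := by gcongr
    have hsum := Finset.sum_le_sum fun (b : T) (_ : b ∈ Finset.univ) ↦ hterm b
    refine le_trans ?_ (neg_le_abs _)
    refine le_trans ?_ (neg_le_neg hsum)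
    have hcard : T.card = m * (m * K) := by simp [T, Finset.card_product]
    rw [Finset.sum_const, Finset.card_univ, Fintype.card_coe, hcard, nsmul_eq_mul, mul_neg, neg_neg]
    rw [div_le_iff₀ (by positivity)] at hK
    -- The number of wells cancels against `ν²`; only `K` controls the size.
    have he : ((m * (m * K) : ℕ) : ℝ) * (Real.pi / (2048 * ν ^ 2)) =
        K * ρ ^ 2 / (8192 * Real.pi) := by
      rw [hνdef]
      push_cast
      field_simp
      ring
    rw [he, le_div_iff₀ (by positivity)]
    exact hK

/-! ### The quadratic correction and the final assembly. -/

theorem integral_pureSecondDeriv_mul_norm_sq {n : ℕ} {Ω : Opens (Eucl n)} (φ : 𝓓(Ω, ℝ))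
    (i : Fin n) : ∫ x, φ.pureSecondDeriv i x * (2 * ‖x‖ ^ 2) = 4 * ∫ x, φ x := by
  set v : Eucl n := EuclideanSpace.single i 1
  rw [integral_pureSecondDeriv_mul φ i (f' := fun x ↦ 4 * inner ℝ v x) (f'' := fun _ ↦ 4)
    (by fun_prop) (by fun_prop) (by fun_prop) (fun x ↦ ?_) fun x ↦ ?_, integral_mul_const, mul_comm]
  · have h := ((hasStrictFDerivAt_norm_sq x).hasFDerivAt.const_mul 2).hasLineDerivAt v
    have he : (4 : ℝ) * inner ℝ v x = ((2 : ℝ) • 2 • (innerSL ℝ) x) v := by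
      simp [real_inner_comm v x]
      ring
    exact he ▸ h
  · have h := (((innerSL ℝ v).hasFDerivAt (x := x)).const_mul 4).hasLineDerivAt v
    have he : ((4 : ℝ) • (innerSL ℝ) v) v = 4 := by simp [v]
    rwa [he] at h

theorem LipschitzWith.lipschitzOnWith_norm_sq_add {E : Type*} [SeminormedAddCommGroup E]
    {f : E → ℝ} (hf : LipschitzWith 2 f) :
    LipschitzOnWith 6 (fun x ↦ 2 * ‖x‖ ^ 2 + f x) (Metric.ball 0 1) := by
  refine LipschitzOnWith.of_dist_le_mul fun x hx y hy ↦ ?_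
  rw [mem_ball_zero_iff] at hx hy
  have h := hf.dist_le_mul x y
  have h1 := abs_norm_sub_norm_le x y
  rw [Real.dist_eq] at h
  rw [Real.dist_eq, dist_eq_norm] at *
  have h2 : |2 * ‖x‖ ^ 2 - 2 * ‖y‖ ^ 2| ≤ 4 * ‖x - y‖ := by
    rw [show 2 * ‖x‖ ^ 2 - 2 * ‖y‖ ^ 2 = 2 * (‖x‖ + ‖y‖) * (‖x‖ - ‖y‖) by ring, abs_mul,
      abs_of_nonneg (by positivity)]
    gcongr
    linarith
  rw [add_sub_add_comm]
  refine (abs_add_le _ _).trans ((add_le_add h2 h).trans_eq ?_)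
  push_cast
  ring

/-- There is a Lipschitz function on the unit disc of `ℝ²`, subharmonic in the sense of
distributions, whose distributional derivative `∂₁₁ u` is not a finite signed measure on any
nonempty open subset of the disc. -/
theorem theorem3p1 :
    ∃ u : Eucl 2 → ℝ,
      (∃ K : NNReal, LipschitzOnWith K u (unitBall 2)) ∧
      IsDistribSubharmonicOn (unitBall 2) u ∧
      ∀ Ω' : TopologicalSpace.Opens (Eucl 2), (Ω' : Set (Eucl 2)).Nonempty → Ω' ≤ unitBall 2 →
        ¬ IsFiniteSignedMeasure (pureSecondDeriv 0 (distributionOf Ω' u)) := by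
  -- The index `b` encodes a pair: a point of a dense sequence and a radius `1/(j + 1)`.
  let r : ℕ → ℝ := fun b ↦ 1 / ((Nat.unpair b).2 + 1)
  have hr : ∀ b, 0 < r b := fun b ↦ by positivity
  let q : ℕ → Eucl 2 := fun b ↦ denseSeq (Eucl 2) (Nat.unpair b).1
  -- The block of index `k = Nat.pair b m` must reach `2ᵏ m`, so that mass `m` survives the weight
  -- `2⁻ᵏ`.
  choose V hVL hVb hVs ψ hψ hVψ using fun b m : ℕ ↦
    exists_oscillating_block (q b) (hr b) (2 ^ Nat.pair b m * m)
  let W : ℕ → Eucl 2 → ℝ := fun k ↦ V (Nat.unpair k).1 (Nat.unpair k).2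
  have hWb : ∀ k x, |W k x| ≤ 3 := fun k ↦ hVb _ _
  have hWL : ∀ k, LipschitzWith 1 (W k) := fun k ↦ hVL _ _
  have hWc : ∀ k, Continuous (W k) := fun k ↦ (hWL k).continuous
  let Φ : ℕ → Type := fun b ↦
    {φ : 𝓓(⟨Metric.ball (q b) (r b), Metric.isOpen_ball⟩, ℝ) // ∀ x, |φ x| ≤ 1}
  let D : ∀ b, Φ b → 𝓓(⟨Metric.ball (q b) (r b), Metric.isOpen_ball⟩, ℝ) := fun b φ ↦ φ.1.pureSecondDeriv 0
  obtain ⟨t, ht⟩ := exists_subseries_unbounded (Φ := Φ)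
    (fun b φ ↦ ∫ x, D b φ x * (2 * ‖x‖ ^ 2)) (fun b φ k ↦ (1 / 2) ^ k * ∫ x, D b φ x * W k x)
    (fun b φ ↦ by
      simpa using (hasSum_integral_mul_geometricSubseries hWb hWc (fun _ ↦ true) (D b φ)).summable)
    (fun b N ↦ by
      refine Filter.frequently_atTop.2 fun k₀ ↦ ?_
      refine ⟨Nat.pair b (max k₀ ⌈N⌉₊), (le_max_left _ _).trans (Nat.right_le_pair _ _),
        ⟨ψ _ _, hψ b (max k₀ ⌈N⌉₊)⟩, ?_⟩
      have h := hVψ b (max k₀ ⌈N⌉₊)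
      have hN : N ≤ (max k₀ ⌈N⌉₊ : ℕ) := (Nat.le_ceil N).trans (mod_cast le_max_right _ _)
      rw [abs_mul, abs_of_pos (by positivity), one_div, inv_pow, ← div_eq_inv_mul,
        le_div_iff₀ (by positivity), mul_comm]
      simp only [W, Nat.unpair_pair]
      exact (mul_le_mul_of_nonneg_left hN (by positivity)).trans h)
  have hSL := lipschitzWith_geometricSubseries hWb hWL t
  set S := geometricSubseries W t
  have huc : Continuous fun x ↦ 2 * ‖x‖ ^ 2 + S x := by
    have := hSL.continuous
    fun_prop
  have hsplit : ∀ {Ω : Opens (Eucl 2)} (φ : 𝓓(Ω, ℝ)), ∫ x, φ x * (2 * ‖x‖ ^ 2 + S x) =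
      (∫ x, φ x * (2 * ‖x‖ ^ 2)) + ∫ x, φ x * S x := fun φ ↦ by
    simp only [mul_add (φ _)]
    exact integral_add (φ.integrable_mul_continuous (by fun_prop))
      (φ.integrable_mul_continuous hSL.continuous)
  refine ⟨fun x ↦ 2 * ‖x‖ ^ 2 + S x, ⟨6, hSL.lipschitzOnWith_norm_sq_add⟩,
    ⟨huc.locallyIntegrable.locallyIntegrableOn _, fun φ hφ ↦ ?_⟩, ?_⟩
  · simp only [pureSecondDeriv_apply, distributionOf_apply _ huc, hsplit]
    simp only [integral_pureSecondDeriv_mul_norm_sq, Finset.sum_add_distrib]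
    have h1 := hasSum_sum fun (i : Fin 2) (_ : i ∈ Finset.univ) ↦
      hasSum_integral_mul_geometricSubseries hWb hWc t (φ.pureSecondDeriv i)
    -- The series loses at most `4 · 2 = 8` times `∫ φ`, exactly the `4 + 4` supplied by `2|x|²`;
    -- omitted terms lose nothing.
    have h2 := hasSum_le (fun k ↦ ?_) (hasSum_geometric_two.mul_right (-4 * ∫ x, φ x)) h1
    · simp only [Finset.sum_const, Finset.card_univ, Fintype.card_fin]
      have : geometricSubseries W t = S := rfl
      rw [this, Fin.sum_univ_two] at h2
      norm_num
      linarith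
    · have h0 : 0 ≤ ∫ x, φ x := integral_nonneg hφ
      split_ifs
      · rw [← Finset.mul_sum]
        gcongr
        exact hVs _ _ _ φ hφ
      · simp only [Finset.sum_const_zero]
        exact mul_nonpos_of_nonneg_of_nonpos (by positivity) (by linarith)
  · rintro Ω ⟨x, hx⟩ - hfin
    obtain ⟨C, hC⟩ := hfin.exists_bound
    obtain ⟨ε, hε, hball⟩ := Metric.isOpen_iff.1 Ω.isOpen x hx
    obtain ⟨j, hj⟩ := exists_nat_one_div_lt (half_pos hε)
    obtain ⟨m, hm⟩ := (denseRange_denseSeq (Eucl 2)).exists_dist_lt x (half_pos hε)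
    obtain ⟨φ, hφ⟩ := ht (Nat.pair m j) C
    have hsub : Metric.ball (q (Nat.pair m j)) (r (Nat.pair m j)) ⊆ Ω := by
      refine (Metric.ball_subset_ball' ?_).trans hball
      simp only [q, r, Nat.unpair_pair]
      rw [dist_comm] at hm
      linarith
    let χ : 𝓓(Ω, ℝ) := ⟨φ.1, φ.1.contDiff, φ.1.hasCompactSupport, φ.1.tsupport_subset.trans hsub⟩
    have h := hC χ φ.2
    rw [pureSecondDeriv_apply, distributionOf_apply _ huc] at h
    have hD : ∀ x, χ.pureSecondDeriv 0 x = D _ φ x := fun x ↦ rfl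
    simp only [hD] at h
    rw [hsplit, ← (hasSum_integral_mul_geometricSubseries hWb hWc t (D _ φ)).tsum_eq] at h
    exact hφ.not_ge h
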